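/- Let $(n_k)_{k\ge 1}$ be a sequence of integers with $n_k\ge 2$ for all $k$. A cylinder of rank $k\ge1$ of the Cantor series expansion with bases $(n_k)$ is a closed interval $$\Delta_{\alpha_1\ldots\alpha_k}=\Big[\sum_{i=1}^{k}\frac{\alpha_i}{n_1\cdots n_i},\ \frac{1}{n_1\cdots n_k}+\sum_{i=1}^{k}\frac{\alpha_i}{n_1\cdots n_i}\Big],\qquad \alpha_i\in\{0,1,\ldots,n_i-1\},$$ and $\Phi$ denotes the family of all cylinders of all ranks $k\ge 1$. Write $|U|$ for the diameter of $U$. For $E\subset\mathbb R$ and $\varepsilon>0$, a centered $\varepsilon$-packing of $E$ is an at most countable family of pairwise disjoint open balls of diameter at most $\varepsilon$ with centers in $E$; an $\varepsilon$-packing of $E$ by $\Phi$ is an at most countable family of pairwise disjoint members of $\Phi$ of diameter at most $\varepsilon$, each of which meets $E$. For $\alpha\ge 0$ let $\mathcal P^\alpha_\varepsilon(E)$ (respectively $\mathcal P^\alpha_\varepsilon(E,\Phi)$) be the supremum of $\sum_i|E_i|^\alpha$ over all centered $\varepsilon$-packings $\{E_i\}$ of $E$ (respectively over all $\varepsilon$-packings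 of $E$ by $\Phi$). Put $$\mathcal P^\alpha_0(E)=\lim_{\varepsilon\to0+}\mathcal P^\alpha_\varepsilon(E),\qquad \mathcal P^\alpha(E)=\inf\Big\{\sum_j\mathcal P^\alpha_0(E_j): E\subset\bigcup_j E_j\Big\},\qquad \dim_P(E)=\inf\{\alpha\ge0:\mathcal P^\alpha(E)=0\},$$ where the infimum in the middle is over all at most countable coverings of $E$, and define $\mathcal P^\alpha_0(E,\Phi)$, $\mathcal P^\alpha(E,\Phi)$ and $\dim_P(E,\Phi)$ in the same way from $\mathcal P^\alpha_\varepsilon(E,\Phi)$. The family $\Phi$ is called faithful for the packing dimension on $[0,1]$ if $\dim_P(E,\Phi)=\dim_P(E)$ for every $E\subset[0,1]$. **Theorem.** The family $\Phi$ is faithful for the packing dimension on $[0,1]$ if and only if $$\lim_{k\to\infty}\frac{\ln n_k}{\ln(n_1 n_2\cdots n_{k-1})}=0.$$ -/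

import Mathlib

open Set Filter Topology
open scoped NNReal ENNReal

noncomputable section

/-- A set `P` of pairs (centre, radius) is a (centred) `ε`-packing of `E`: it is at most countable,
the open balls have positive radius, centre in `E` and diameter at most `ε`, and balls with
different indices are disjoint. -/
def IsCenteredPacking {M : Type*} [MetricSpace M] (E : Set M) (ε : ℝ≥0∞)
    (P : Set (M × ℝ)) : Prop :=
  P.Countable ∧
  (∀ p ∈ P, 0 < p.2 ∧ p.1 ∈ E ∧ Metric.ediam (Metric.ball p.1 p.2) ≤ ε) ∧
  P.PairwiseDisjoint (fun p => Metric.ball p.1 p.2)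

/-- A set `S` of subsets of `M` is an uncentred `ε`-packing of `E` by members of the family `Φ`:
it is at most countable, its members belong to `Φ`, have diameter at most `ε`, meet `E`, and are
pairwise disjoint. -/
def IsPackingBy {M : Type*} [MetricSpace M] (Φ : Set (Set M)) (E : Set M) (ε : ℝ≥0∞)
    (S : Set (Set M)) : Prop :=
  S.Countable ∧ S ⊆ Φ ∧
  (∀ U ∈ S, Metric.ediam U ≤ ε ∧ (U ∩ E).Nonempty) ∧
  S.PairwiseDisjoint id

/-- The `α`-dimensional packing pre-measure `P^α_ε(E)`: the supremum of `∑ |E_i|^α` over all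
centred `ε`-packings of `E`. -/
def packingPre {M : Type*} [MetricSpace M] (α : ℝ≥0) (ε : ℝ≥0∞) (E : Set M) : ℝ≥0∞ :=
  ⨆ (P : Set (M × ℝ)) (_ : IsCenteredPacking E ε P),
    ∑' p : P, Metric.ediam (Metric.ball p.1.1 p.1.2) ^ (α : ℝ)

/-- The `α`-dimensional packing pre-measure `P^α_ε(E, Φ)` with respect to the family `Φ`. -/
def packingPreWrt {M : Type*} [MetricSpace M] (Φ : Set (Set M)) (α : ℝ≥0) (ε : ℝ≥0∞)
    (E : Set M) : ℝ≥0∞ :=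
  ⨆ (S : Set (Set M)) (_ : IsPackingBy Φ E ε S), ∑' U : S, Metric.ediam (U : Set M) ^ (α : ℝ)

/-- The quasi-measure attached to a pre-measure `p ε E` which is monotone in `ε`: its limit as
`ε → 0+`, written as an infimum (see `tendsto_packingPre` and `tendsto_packingPreWrt`). -/
def quasiMeasure {M : Type*} (p : ℝ≥0∞ → Set M → ℝ≥0∞) (E : Set M) : ℝ≥0∞ :=
  ⨅ (ε : ℝ≥0∞) (_ : 0 < ε), p ε E

/-- The measure attached to a pre-measure: the infimum of `∑ quasiMeasure p (F j)` over all
at most countable coverings of `E` (finite coverings are padded with empty sets). -/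
def packingMeasureOf {M : Type*} (p : ℝ≥0∞ → Set M → ℝ≥0∞) (E : Set M) : ℝ≥0∞ :=
  ⨅ (F : ℕ → Set M) (_ : E ⊆ ⋃ j, F j), ∑' j, quasiMeasure p (F j)

/-- The packing dimension `dim_P E = inf {α ≥ 0 : P^α(E) = 0}`. -/
def packingDim {M : Type*} [MetricSpace M] (E : Set M) : ℝ≥0∞ :=
  ⨅ (α : ℝ≥0) (_ : packingMeasureOf (packingPre α) E = 0), (α : ℝ≥0∞)

/-- The packing dimension `dim_P (E, Φ) = inf {α ≥ 0 : P^α(E, Φ) = 0}` with respect to `Φ`. -/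
def packingDimWrt {M : Type*} [MetricSpace M] (Φ : Set (Set M)) (E : Set M) : ℝ≥0∞ :=
  ⨅ (α : ℝ≥0) (_ : packingMeasureOf (packingPreWrt Φ α) E = 0), (α : ℝ≥0∞)

/-- `Φ` is faithful for the calculation of the packing dimension on `[0, 1]`. -/
def IsPackingFaithful (Φ : Set (Set ℝ)) : Prop :=
  ∀ E : Set ℝ, E ⊆ Icc 0 1 → packingDimWrt Φ E = packingDim E

/-- The cylinder of rank `k` with digits `a 0, …, a (k - 1)` of the Cantor series expansion with
bases `n 0, n 1, …` (indices start at `0`): the closed interval of length `1 / (n 0 ⋯ n (k - 1))`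
whose left end point is `∑ i < k, a i / (n 0 ⋯ n i)`. -/
def cantorCylinder (n a : ℕ → ℕ) (k : ℕ) : Set ℝ :=
  Icc (∑ i ∈ Finset.range k, (a i : ℝ) / ∏ j ∈ Finset.range (i + 1), (n j : ℝ))
    (1 / (∏ j ∈ Finset.range k, (n j : ℝ)) +
      ∑ i ∈ Finset.range k, (a i : ℝ) / ∏ j ∈ Finset.range (i + 1), (n j : ℝ))

/-- The family of all cylinders of ranks `k = 1, 2, …`. -/
def cantorCylinders (n : ℕ → ℕ) : Set (Set ℝ) :=
  {D | ∃ k : ℕ, 1 ≤ k ∧ ∃ a : ℕ → ℕ, (∀ i < k, a i < n i) ∧ D = cantorCylinder n a k}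

theorem packingPre_mono {M : Type*} [MetricSpace M] (α : ℝ≥0) (E : Set M) :
    Monotone (fun ε => packingPre α ε E) := by
  intro ε ε' h
  refine iSup₂_le fun P hP => ?_
  exact le_iSup₂_of_le P
    ⟨hP.1, fun p hp => ⟨(hP.2.1 p hp).1, (hP.2.1 p hp).2.1, (hP.2.1 p hp).2.2.trans h⟩, hP.2.2⟩
    le_rfl

theorem packingPreWrt_mono {M : Type*} [MetricSpace M] (Φ : Set (Set M)) (α : ℝ≥0) (E : Set M) :
    Monotone (fun ε => packingPreWrt Φ α ε E) := by
  intro ε ε' h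
  refine iSup₂_le fun S hS => ?_
  exact le_iSup₂_of_le S
    ⟨hS.1, hS.2.1, fun U hU => ⟨(hS.2.2.1 U hU).1.trans h, (hS.2.2.1 U hU).2⟩, hS.2.2.2⟩
    le_rfl

theorem tendsto_packingPre {M : Type*} [MetricSpace M] (α : ℝ≥0) (E : Set M) :
    Tendsto (fun ε => packingPre α ε E) (𝓝[>] 0) (𝓝 (quasiMeasure (packingPre α) E)) := by
  have h := (packingPre_mono α E).tendsto_nhdsGT 0
  rwa [sInf_image] at h

theorem tendsto_packingPreWrt {M : Type*} [MetricSpace M] (Φ : Set (Set M)) (α : ℝ≥0)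
    (E : Set M) :
    Tendsto (fun ε => packingPreWrt Φ α ε E) (𝓝[>] 0)
      (𝓝 (quasiMeasure (packingPreWrt Φ α) E)) := by
  have h := (packingPreWrt_mono Φ α E).tendsto_nhdsGT 0
  rwa [sInf_image] at h

end

/-! ### Pre-measures and packings -/

/-! Write `N_k` for the product of the first `k` bases. Two facts drive the proof.

For all bases, `dim_P(E, Φ) ≤ dim_P(E)`. Picking one point of `E` in every third rank `k` cell that
meets `E` gives a centred packing, so finite packing premeasures bound the number of cells met at
every small mesh (`encard_meetingCells_mul_le`). Since `N_k ≥ 2 ^ k`, summing over ranks costs an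
arbitrarily small exponent (`quasiMeasure_packingPreWrt_eq_zero`).

The reverse inequality depends on the gaps between the scales `1 / N_k`. If eventually `n_k ≤ N_k ^
δ`, each small ball of radius `r` contains a cylinder through its centre of length at least about `r
^ (1 + δ)` (`exists_cylinder_subset_ball`), so the dimensions differ at most by the factor `1 + δ`,
and `δ` is arbitrary.

If instead `n_k ≥ N_k ^ (2 η)` infinitely often, a set is built that looks bigger between the scales
than at them. At sparse positions about `N_k ^ η` equally spaced digits are allowed, elsewhere only
the digit `0`. At the cylinder scales the set has dimension at most `(e + η) / (1 + 2 η)`, with `e`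
small (`packingDimWrt_greedySet_le`); at the intermediate scale `N_k ^ (-(1 + η))` the points are
separated, and Baire category turns this into `dim_P ≥ η / (1 + η)` (`le_packingDim_greedySet`),
which is larger. -/

theorem exists_cover_quasiMeasure_lt_top {M : Type*} {p : ℝ≥0∞ → Set M → ℝ≥0∞} {E : Set M}
    (h : packingMeasureOf p E = 0) :
    ∃ F : ℕ → Set M, E ⊆ ⋃ j, F j ∧ ∀ j, quasiMeasure p (F j) < ⊤ := by
  have h1 : packingMeasureOf p E < 1 := by rw [h]; exact one_pos
  obtain ⟨F, hF⟩ := iInf_lt_iff.1 h1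
  obtain ⟨hE, hF⟩ := iInf_lt_iff.1 hF
  exact ⟨F, hE, fun j => (ENNReal.le_tsum j).trans_lt (hF.trans ENNReal.one_lt_top)⟩

theorem exists_pos_lt_top_of_quasiMeasure_lt_top {M : Type*} {p : ℝ≥0∞ → Set M → ℝ≥0∞}
    {F : Set M} (h : quasiMeasure p F < ⊤) : ∃ ε, 0 < ε ∧ p ε F < ⊤ := by
  obtain ⟨ε, hε⟩ := iInf_lt_iff.1 h
  obtain ⟨h0, hε⟩ := iInf_lt_iff.1 hε
  exact ⟨ε, h0, hε⟩

theorem packingMeasureOf_eq_zero_of_cover {M : Type*} {p : ℝ≥0∞ → Set M → ℝ≥0∞} {E : Set M}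
    {F : ℕ → Set M} (hE : E ⊆ ⋃ j, F j) (h : ∀ j, quasiMeasure p (F j) = 0) :
    packingMeasureOf p E = 0 :=
  le_antisymm (iInf₂_le_of_le F hE (by simp [h])) (zero_le)

theorem quasiMeasure_eq_zero_of_le_rpow {M : Type*} {p : ℝ≥0∞ → Set M → ℝ≥0∞} {F : Set M}
    {K : ℝ≥0∞} (hK : K ≠ ⊤) {s : ℝ} (hs : 0 < s) {ε₀ : ℝ≥0∞} (hε₀ : 0 < ε₀)
    (h : ∀ ε, 0 < ε → ε ≤ ε₀ → p ε F ≤ K * ε ^ s) : quasiMeasure p F = 0 := by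
  have hlim : Tendsto (fun ε : ℝ≥0∞ => K * ε ^ s) (𝓝[>] 0) (𝓝 0) := by
    have h1 : Tendsto (fun ε : ℝ≥0∞ => ε ^ s) (𝓝[>] 0) (𝓝 (0 ^ s)) :=
      (ENNReal.continuous_rpow_const.tendsto 0).mono_left nhdsWithin_le_nhds
    rw [ENNReal.zero_rpow_of_pos hs] at h1
    simpa using ENNReal.Tendsto.const_mul h1 (Or.inr hK)
  refine le_antisymm (ge_of_tendsto hlim ?_) (zero_le)
  filter_upwards [Ioc_mem_nhdsGT hε₀] with ε hε
  exact (iInf₂_le ε hε.1).trans (h ε hε.1 hε.2)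

theorem ediam_real_ball {x r : ℝ} : Metric.ediam (Metric.ball x r) = ENNReal.ofReal (2 * r) := by
  rw [Real.ball_eq_Ioo, Real.ediam_Ioo]
  congr 1
  ring

/-- Points of `F` that are `2 r`-separated give a centred packing of `F`. -/
theorem encard_mul_le_packingPre {ι : Type*} [Countable ι] {F : Set ℝ} {α : ℝ≥0} {ε : ℝ≥0∞}
    {r : ℝ} (hr : 0 < r) (hε : ENNReal.ofReal (2 * r) ≤ ε) (T : Set ι) (x : ι → ℝ)
    (hx : ∀ i ∈ T, x i ∈ F) (hsep : ∀ i ∈ T, ∀ j ∈ T, i ≠ j → 2 * r ≤ dist (x i) (x j)) :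
    (T.encard : ℝ≥0∞) * ENNReal.ofReal (2 * r) ^ (α : ℝ) ≤ packingPre α ε F := by
  have hinj : InjOn (fun i => (x i, r)) T := by
    intro i hi j hj hij
    by_contra hne
    have h1 := hsep i hi j hj hne
    rw [show x i = x j from (Prod.ext_iff.1 hij).1, dist_self] at h1
    linarith
  have hP : IsCenteredPacking F ε ((fun i => (x i, r)) '' T) := by
    refine ⟨T.to_countable.image _, ?_, ?_⟩
    · rintro _ ⟨i, hi, rfl⟩
      exact ⟨hr, hx i hi, by rw [ediam_real_ball]; exact hε⟩
    · rintro _ ⟨i, hi, rfl⟩ _ ⟨j, hj, rfl⟩ hne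
      refine Metric.ball_disjoint_ball ?_
      have := hsep i hi j hj (fun h => hne (by rw [h]))
      simp only
      linarith
  refine le_iSup₂_of_le _ hP ?_
  rw [← hinj.encard_image, ← ENNReal.tsum_set_const]
  refine ENNReal.tsum_le_tsum ?_
  rintro ⟨_, i, hi, rfl⟩
  simp only [ediam_real_ball]
  exact le_rfl

/-! ### Cells and cylinders -/

/-- The product of the first `k` bases. -/
def basesProd (n : ℕ → ℕ) (k : ℕ) : ℕ := ∏ i ∈ Finset.range k, n i

/-- The closed interval `[i / N, (i + 1) / N]`. -/
def gridCell (N i : ℕ) : Set ℝ := Icc ((i : ℝ) / N) ((i + 1 : ℝ) / N)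

/-- The position of the cylinder with digits `a` among the cylinders of rank `k`. -/
def cylinderIndex (n a : ℕ → ℕ) : ℕ → ℕ
  | 0 => 0
  | k + 1 => cylinderIndex n a k * n k + a k

theorem basesProd_succ (n : ℕ → ℕ) (k : ℕ) : basesProd n (k + 1) = basesProd n k * n k :=
  Finset.prod_range_succ _ _

theorem two_pow_le_basesProd {n : ℕ → ℕ} (hn : ∀ k, 2 ≤ n k) (k : ℕ) : 2 ^ k ≤ basesProd n k := by
  simpa [basesProd] using Finset.pow_card_le_prod (Finset.range k) n 2 (fun i _ => hn i)

theorem basesProd_pos {n : ℕ → ℕ} (hn : ∀ k, 2 ≤ n k) (k : ℕ) : 0 < basesProd n k :=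
  lt_of_lt_of_le (by positivity) (two_pow_le_basesProd hn k)

theorem basesProd_strictMono {n : ℕ → ℕ} (hn : ∀ k, 2 ≤ n k) : StrictMono (basesProd n) := by
  refine strictMono_nat_of_lt_succ fun k => ?_
  rw [basesProd_succ]
  nlinarith [basesProd_pos hn k, hn k]

theorem tendsto_basesProd {n : ℕ → ℕ} (hn : ∀ k, 2 ≤ n k) :
    Tendsto (fun k => (basesProd n k : ℝ)) atTop atTop :=
  tendsto_natCast_atTop_atTop.comp (basesProd_strictMono hn).tendsto_atTop

theorem ediam_gridCell {N : ℕ} (hN : 0 < N) (i : ℕ) : Metric.ediam (gridCell N i) = (N : ℝ≥0∞)⁻¹ := by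
  rw [gridCell, Real.ediam_Icc, ← sub_div, add_sub_cancel_left, one_div,
    ENNReal.ofReal_inv_of_pos (by exact_mod_cast hN), ENNReal.ofReal_natCast]

theorem sum_digits_eq {n : ℕ → ℕ} (hn : ∀ k, 2 ≤ n k) (a : ℕ → ℕ) (k : ℕ) :
    ∑ i ∈ Finset.range k, (a i : ℝ) / ∏ j ∈ Finset.range (i + 1), (n j : ℝ) =
      (cylinderIndex n a k : ℝ) / basesProd n k := by
  induction k with
  | zero => simp [cylinderIndex]
  | succ k ih =>
    have h1 : (basesProd n k : ℝ) ≠ 0 := by exact_mod_cast (basesProd_pos hn k).ne'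
    have h2 : (n k : ℝ) ≠ 0 := by have := hn k; positivity
    have h3 : ∏ j ∈ Finset.range (k + 1), (n j : ℝ) = basesProd n k * n k := by
      rw [Finset.prod_range_succ, basesProd]; push_cast; rfl
    rw [Finset.sum_range_succ, ih, h3, basesProd_succ, cylinderIndex]
    push_cast
    field_simp

theorem cantorCylinder_eq_gridCell {n : ℕ → ℕ} (hn : ∀ k, 2 ≤ n k) (a : ℕ → ℕ) (k : ℕ) :
    cantorCylinder n a k = gridCell (basesProd n k) (cylinderIndex n a k) := by
  rw [cantorCylinder, sum_digits_eq hn, gridCell, ← Nat.cast_prod, ← basesProd, ← add_div, add_comm]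

theorem cylinderIndex_congr {n a b : ℕ → ℕ} {k : ℕ} (h : ∀ i < k, a i = b i) :
    cylinderIndex n a k = cylinderIndex n b k := by
  induction k with
  | zero => rfl
  | succ k ih => rw [cylinderIndex, cylinderIndex, ih fun i hi => h i (by omega), h k (by omega)]

theorem exists_digits {n : ℕ → ℕ} (k : ℕ) : ∀ i < basesProd n k,
    ∃ a : ℕ → ℕ, (∀ l < k, a l < n l) ∧ cylinderIndex n a k = i := by
  induction k with
  | zero =>
    intro i hi
    exact ⟨0, by simp, by simp [basesProd] at hi; simp [cylinderIndex, hi]⟩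
  | succ k ih =>
    intro i hi
    rw [basesProd_succ] at hi
    have hnk : 0 < n k := Nat.pos_of_ne_zero (by rintro h; simp [h] at hi)
    obtain ⟨a, ha, hai⟩ := ih (i / n k) ((Nat.div_lt_iff_lt_mul hnk).2 hi)
    refine ⟨Function.update a k (i % n k), fun l hl => ?_, ?_⟩
    · rcases eq_or_ne l k with rfl | hlk
      · simpa using Nat.mod_lt _ hnk
      · simpa [hlk] using ha l (by omega)
    · rw [cylinderIndex, cylinderIndex_congr (b := a), hai]
      · simpa using Nat.div_add_mod' i (n k)
      · intro l hl
        simp [hl.ne]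

theorem exists_mem_gridCell {N : ℕ} (hN : 0 < N) {x : ℝ} (hx : x ∈ Icc (0 : ℝ) 1) :
    ∃ i < N, x ∈ gridCell N i := by
  have hN' : (0 : ℝ) < N := by exact_mod_cast hN
  have hxN : 0 ≤ x * N := mul_nonneg hx.1 hN'.le
  rcases hx.2.lt_or_eq with h1 | rfl
  · refine ⟨⌊x * N⌋₊, ?_, ?_, ?_⟩
    · rw [Nat.floor_lt hxN]; nlinarith
    · rw [div_le_iff₀ hN']; exact Nat.floor_le hxN
    · rw [le_div_iff₀ hN']; exact (Nat.lt_floor_add_one _).le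
  · refine ⟨N - 1, by omega, ?_, ?_⟩ <;> rw [Nat.cast_sub hN]
    · rw [div_le_iff₀ hN']; simp
    · rw [le_div_iff₀ hN']; simp

theorem exists_cylinder_mem {n : ℕ → ℕ} (hn : ∀ k, 2 ≤ n k) {k : ℕ} (hk : 1 ≤ k) {x : ℝ}
    (hx : x ∈ Icc (0 : ℝ) 1) :
    ∃ i, gridCell (basesProd n k) i ∈ cantorCylinders n ∧ x ∈ gridCell (basesProd n k) i := by
  obtain ⟨i, hi, hxi⟩ := exists_mem_gridCell (basesProd_pos hn k) hx
  obtain ⟨a, ha, rfl⟩ := exists_digits k i hi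
  exact ⟨_, ⟨k, hk, a, ha, (cantorCylinder_eq_gridCell hn a k).symm⟩, hxi⟩

theorem exists_eq_gridCell {n : ℕ → ℕ} (hn : ∀ k, 2 ≤ n k) {U : Set ℝ}
    (hU : U ∈ cantorCylinders n) : ∃ q : ℕ × ℕ, U = gridCell (basesProd n q.1) q.2 := by
  obtain ⟨k, -, a, -, rfl⟩ := hU
  exact ⟨(k, _), cantorCylinder_eq_gridCell hn a k⟩

/-! ### Counting cylinders -/

/-- The indices of the cells of the grid of mesh `1 / N` that meet `F`. -/
def meetingCells (N : ℕ) (F : Set ℝ) : Set ℕ := {i | (gridCell N i ∩ F).Nonempty}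

theorem tsum_inv_basesProd_rpow_ne_top {n : ℕ → ℕ} (hn : ∀ k, 2 ≤ n k) {s : ℝ} (hs : 0 < s) :
    ∑' j, ((basesProd n j : ℝ≥0∞)⁻¹) ^ s ≠ ⊤ := by
  have h1 : ∑' j, ((basesProd n j : ℝ≥0∞)⁻¹) ^ s ≤ ∑' j : ℕ, ((2⁻¹ : ℝ≥0∞) ^ s) ^ j := by
    refine ENNReal.tsum_le_tsum fun j => ?_
    rw [← ENNReal.rpow_natCast, ← ENNReal.rpow_mul, mul_comm, ENNReal.rpow_mul,
      ENNReal.rpow_natCast]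
    refine ENNReal.rpow_le_rpow ?_ hs.le
    rw [← ENNReal.inv_pow]
    exact ENNReal.inv_le_inv.2 (by exact_mod_cast two_pow_le_basesProd hn j)
  refine ne_top_of_le_ne_top ?_ h1
  rw [ENNReal.tsum_geometric, ENNReal.inv_ne_top, Ne, tsub_eq_zero_iff_le, not_le]
  exact ENNReal.rpow_lt_one (by simp) hs

/-- With `w_j = 1 / N_j` and `β = α + 2 s`, rank `j` contributes at most `M * w_j ^ s * w_j ^ s`.
One factor is at most `ε ^ s` and tends to zero; the other is summable over the ranks. -/
theorem quasiMeasure_packingPreWrt_eq_zero {n : ℕ → ℕ} (hn : ∀ k, 2 ≤ n k) {F : Set ℝ}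
    {α β : ℝ≥0} (hαβ : α < β) {M ε₀ : ℝ≥0∞} (hM : M ≠ ⊤) (hε₀ : 0 < ε₀)
    (h : ∀ j, (basesProd n j : ℝ≥0∞)⁻¹ ≤ ε₀ →
      ((meetingCells (basesProd n j) F).encard : ℝ≥0∞) * ((basesProd n j : ℝ≥0∞)⁻¹) ^ (α : ℝ) ≤ M) :
    quasiMeasure (packingPreWrt (cantorCylinders n) β) F = 0 := by
  set w : ℕ → ℝ≥0∞ := fun j => (basesProd n j : ℝ≥0∞)⁻¹ with hw
  set s : ℝ := ((β : ℝ) - α) / 2 with hs_def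
  have hs : 0 < s := by have : (α : ℝ) < β := hαβ; rw [hs_def]; linarith
  have hβ : (β : ℝ) = α + s + s := by rw [hs_def]; ring
  refine quasiMeasure_eq_zero_of_le_rpow (K := M * ∑' j, w j ^ s)
    (ENNReal.mul_ne_top hM (tsum_inv_basesProd_rpow_ne_top hn hs)) hs hε₀ fun ε _ hε => ?_
  refine iSup₂_le fun S hS => ?_
  choose! φ hφ using fun U (hU : U ∈ cantorCylinders n) => exists_eq_gridCell hn hU
  have hφS : ∀ U : S, (U : Set ℝ) = gridCell (basesProd n (φ U).1) (φ U).2 :=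
    fun U => hφ U (hS.2.1 U.2)
  -- Extending the summand by zero to all pairs (rank, position) bounds the packing sum by a count
  -- over entire grids.
  let g : ℕ × ℕ → ℝ≥0∞ := fun q =>
    (meetingCells (basesProd n q.1) F).indicator
      (fun _ => if w q.1 ≤ ε then w q.1 ^ (β : ℝ) else 0) q.2
  have hg : ∀ U : S, Metric.ediam (U : Set ℝ) ^ (β : ℝ) = g (φ U) := by
    intro U
    have h1 := hS.2.2.1 U U.2
    have h2 : Metric.ediam (U : Set ℝ) = w (φ U).1 := by
      conv_lhs => rw [hφS U]
      exact ediam_gridCell (basesProd_pos hn _) _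
    have h3 : (φ U).2 ∈ meetingCells (basesProd n (φ U).1) F := by
      rw [meetingCells, mem_ofPred_eq, ← hφS U]; exact h1.2
    simp only [g, indicator_of_mem h3]
    rw [← h2, if_pos h1.1]
  have hinj : Function.Injective fun U : S => φ U := fun U V hUV => by
    apply Subtype.ext
    rw [hφS U, hφS V, show φ U = φ V from hUV]
  calc ∑' U : S, Metric.ediam (U : Set ℝ) ^ (β : ℝ) = ∑' U : S, g (φ U) := by simp_rw [hg]
    _ ≤ ∑' q, g q := ENNReal.tsum_comp_le_tsum_of_injective hinj g
    _ = ∑' j, ∑' i, g (j, i) := ENNReal.tsum_prod (f := fun j i => g (j, i))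
    _ ≤ ∑' j, M * ε ^ s * w j ^ s := by
      refine ENNReal.tsum_le_tsum fun j => ?_
      simp only [g]
      rw [← tsum_subtype, ENNReal.tsum_set_const]
      split_ifs with hj
      · have hw0 : w j ≠ 0 := by simp [hw]
        have hwt : w j ≠ ⊤ := by simp [hw, (basesProd_pos hn j).ne']
        rw [hβ, ENNReal.rpow_add _ _ hw0 hwt, ENNReal.rpow_add _ _ hw0 hwt, ← mul_assoc,
          ← mul_assoc]
        gcongr
        exact h j (hj.trans hε)
      · simp
    _ = M * (∑' j, w j ^ s) * ε ^ s := by rw [ENNReal.tsum_mul_left]; ring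

/-- Two distinct cells with the same index modulo 3 have at least two full cells between them, so
points chosen in them are `2 / N`-separated. The three residue classes give the factor 3. -/
theorem encard_meetingCells_mul_le {N : ℕ} (hN : 0 < N) {F : Set ℝ} {α : ℝ≥0} {ε : ℝ≥0∞}
    (hε : 2 * (N : ℝ≥0∞)⁻¹ ≤ ε) :
    ((meetingCells N F).encard : ℝ≥0∞) * ((N : ℝ≥0∞)⁻¹) ^ (α : ℝ) ≤ 3 * packingPre α ε F := by
  have hN' : (0 : ℝ) < N := by exact_mod_cast hN
  have hcell : ENNReal.ofReal (2 * (N : ℝ)⁻¹) = 2 * (N : ℝ≥0∞)⁻¹ := by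
    rw [ENNReal.ofReal_mul (by norm_num), ENNReal.ofReal_inv_of_pos hN', ENNReal.ofReal_natCast]
    simp
  choose! x hx using fun i (hi : i ∈ meetingCells N F) => hi
  have key : ∀ c : ℕ, (({i | i ∈ meetingCells N F ∧ i % 3 = c} : Set ℕ).encard : ℝ≥0∞) *
      ((N : ℝ≥0∞)⁻¹) ^ (α : ℝ) ≤ packingPre α ε F := by
    intro c
    have hlt : ∀ i ∈ {i | i ∈ meetingCells N F ∧ i % 3 = c},
        ∀ j ∈ {i | i ∈ meetingCells N F ∧ i % 3 = c}, i < j → 2 * (N : ℝ)⁻¹ ≤ x j - x i := by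
      intro i hi j hj hij
      have h3 : i + 3 ≤ j := by have := hi.2; have := hj.2; omega
      have h3' : (i : ℝ) + 3 ≤ j := by exact_mod_cast h3
      have h1 := (hx i hi.1).1.2
      have h2 := (hx j hj.1).1.1
      have h4 : (i + 3 : ℝ) / N ≤ j / N := by gcongr
      have h5 : (i + 3 : ℝ) / N = (i + 1 : ℝ) / N + 2 * (N : ℝ)⁻¹ := by field_simp; ring
      linarith
    refine le_trans ?_ (encard_mul_le_packingPre (inv_pos.2 hN') (hcell.trans_le hε)
      {i | i ∈ meetingCells N F ∧ i % 3 = c} x (fun i hi => (hx i hi.1).2) ?_)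
    · gcongr
      rw [hcell]
      exact le_mul_of_one_le_left (zero_le) (by norm_num)
    · intro i hi j hj hij
      rw [Real.dist_eq]
      rcases lt_or_gt_of_ne hij with h | h
      · rw [abs_sub_comm]; exact (hlt i hi j hj h).trans (le_abs_self _)
      · exact (hlt j hj i hi h).trans (le_abs_self _)
  have hsub : meetingCells N F ⊆ {i | i ∈ meetingCells N F ∧ i % 3 = 0} ∪
      {i | i ∈ meetingCells N F ∧ i % 3 = 1} ∪ {i | i ∈ meetingCells N F ∧ i % 3 = 2} := by
    intro i hi
    have : i % 3 = 0 ∨ i % 3 = 1 ∨ i % 3 = 2 := by omega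
    simpa [hi, or_assoc] using this
  have hcard := ((encard_le_encard hsub).trans (encard_union_le _ _)).trans
    (add_le_add_left (encard_union_le _ _) _)
  have hcard' : ((meetingCells N F).encard : ℝ≥0∞) ≤
      ({i | i ∈ meetingCells N F ∧ i % 3 = 0} : Set ℕ).encard +
      ({i | i ∈ meetingCells N F ∧ i % 3 = 1} : Set ℕ).encard +
      ({i | i ∈ meetingCells N F ∧ i % 3 = 2} : Set ℕ).encard := by exact_mod_cast hcard
  calc _ ≤ _ := mul_le_mul_left hcard' _
    _ ≤ packingPre α ε F + packingPre α ε F + packingPre α ε F := by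
      rw [add_mul, add_mul]
      exact add_le_add (add_le_add (key 0) (key 1)) (key 2)
    _ = 3 * packingPre α ε F := by ring

theorem packingDimWrt_cantorCylinders_le {n : ℕ → ℕ} (hn : ∀ k, 2 ≤ n k) (E : Set ℝ) :
    packingDimWrt (cantorCylinders n) E ≤ packingDim E := by
  refine le_iInf₂ fun α hα => ?_
  refine le_of_forall_gt_imp_ge_of_dense fun b hb => ?_
  obtain ⟨β, hαβ, hβb⟩ := ENNReal.lt_iff_exists_nnreal_btwn.1 hb
  refine (iInf₂_le β ?_).trans hβb.le
  obtain ⟨F, hEF, hF⟩ := exists_cover_quasiMeasure_lt_top hα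
  refine packingMeasureOf_eq_zero_of_cover hEF fun j => ?_
  obtain ⟨ε, hε, hlt⟩ := exists_pos_lt_top_of_quasiMeasure_lt_top (hF j)
  refine quasiMeasure_packingPreWrt_eq_zero hn (ENNReal.coe_lt_coe.1 hαβ)
    (M := 3 * packingPre α ε (F j)) (ENNReal.mul_ne_top (by norm_num) hlt.ne)
    (ENNReal.half_pos hε.ne') fun k hk => ?_
  refine encard_meetingCells_mul_le (basesProd_pos hn k) ?_
  calc 2 * (basesProd n k : ℝ≥0∞)⁻¹ ≤ 2 * (ε / 2) := by gcongr
    _ = ε := ENNReal.mul_div_cancel (by norm_num) (by norm_num)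

/-! ### Slowly growing bases -/

/-- Take the first rank whose mesh is below `r`: a cylinder of that rank through `x` stays in the
ball. The previous mesh is at least `r`, and the growth bound says that one step raises `N` at most
to the power `1 + δ`. -/
theorem exists_cylinder_subset_ball {n : ℕ → ℕ} (hn : ∀ k, 2 ≤ n k) {δ : ℝ} (hδ : 0 < δ)
    (hgrow : ∀ᶠ k in atTop, (n k : ℝ) ≤ (basesProd n k : ℝ) ^ δ) :
    ∃ ε₀ : ℝ≥0∞, 0 < ε₀ ∧ ∀ x ∈ Icc (0 : ℝ) 1, ∀ r : ℝ, 0 < r → ENNReal.ofReal (2 * r) ≤ ε₀ →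
      ∃ U ∈ cantorCylinders n, x ∈ U ∧ U ⊆ Metric.ball x r ∧
        ENNReal.ofReal (2 * r) ^ (1 + δ) ≤ 2 ^ (1 + δ) * Metric.ediam U := by
  obtain ⟨k₀, hk₀⟩ := eventually_atTop.1 hgrow
  have hpos : ∀ k, (0 : ℝ) < basesProd n k := fun k => by exact_mod_cast basesProd_pos hn k
  -- This threshold forces the first rank with mesh below `r` to exceed `k₀`, so the growth bound
  -- applies at the rank before it.
  refine ⟨ENNReal.ofReal (basesProd n k₀ : ℝ)⁻¹, ENNReal.ofReal_pos.2 (inv_pos.2 (hpos k₀)),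
    fun x hx r hr hrε => ?_⟩
  have hr₀ : 2 * r ≤ (basesProd n k₀ : ℝ)⁻¹ :=
    (ENNReal.ofReal_le_ofReal_iff (inv_pos.2 (hpos k₀)).le).1 hrε
  have hex : ∃ k, (basesProd n k : ℝ)⁻¹ < r :=
    ((tendsto_inv_atTop_zero.comp (tendsto_basesProd hn)).eventually_lt_const hr).exists
  classical
  obtain ⟨k, hk, hmin⟩ : ∃ k, (basesProd n k : ℝ)⁻¹ < r ∧ ∀ l < k, r ≤ (basesProd n l : ℝ)⁻¹ :=
    ⟨Nat.find hex, Nat.find_spec hex, fun l hl => not_lt.1 (Nat.find_min hex hl)⟩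
  have hk₀k : k₀ < k := by
    by_contra hcon
    have h1 : (basesProd n k : ℝ) ≤ basesProd n k₀ := by
      exact_mod_cast (basesProd_strictMono hn).monotone (not_lt.1 hcon)
    have h2 := inv_anti₀ (hpos k) h1
    linarith
  obtain ⟨l, rfl⟩ : ∃ l, k = l + 1 := ⟨k - 1, by omega⟩
  have hl : r ≤ (basesProd n l : ℝ)⁻¹ := hmin l (by omega)
  obtain ⟨i, hi, hxi⟩ := exists_cylinder_mem hn (k := l + 1) (by omega) hx
  refine ⟨_, hi, hxi, fun y hy => ?_, ?_⟩
  · have h1 := Real.dist_le_of_mem_Icc hy hxi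
    rw [← sub_div, add_sub_cancel_left, one_div] at h1
    exact h1.trans_lt hk
  · have hgr := hk₀ l (by omega)
    have h1 : (basesProd n (l + 1) : ℝ) ≤ (basesProd n l : ℝ) ^ (1 + δ) := by
      rw [basesProd_succ, Real.rpow_add (hpos l), Real.rpow_one]
      push_cast
      exact mul_le_mul_of_nonneg_left hgr (hpos l).le
    have h2 : (2 * r) ^ (1 + δ) ≤ 2 ^ (1 + δ) * (basesProd n (l + 1) : ℝ)⁻¹ := by
      rw [Real.mul_rpow (by norm_num) hr.le]
      refine mul_le_mul_of_nonneg_left ?_ (by positivity)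
      calc r ^ (1 + δ) ≤ ((basesProd n l : ℝ)⁻¹) ^ (1 + δ) := by gcongr
        _ = ((basesProd n l : ℝ) ^ (1 + δ))⁻¹ := Real.inv_rpow (hpos l).le _
        _ ≤ _ := inv_anti₀ (hpos _) h1
    rw [ediam_gridCell (basesProd_pos hn _), ENNReal.ofReal_rpow_of_pos (by positivity)]
    refine (ENNReal.ofReal_le_ofReal h2).trans_eq ?_
    rw [ENNReal.ofReal_mul (by positivity), ENNReal.ofReal_inv_of_pos (hpos _),
      ENNReal.ofReal_natCast, ← ENNReal.ofReal_rpow_of_pos (by norm_num), ENNReal.ofReal_ofNat]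

/-- Replacing each ball by a cylinder inside it through its centre keeps disjointness and gives a
packing by cylinders. The spare exponent `β - (1 + δ) * α` supplies a factor that vanishes with `ε`.
-/
theorem quasiMeasure_packingPre_eq_zero {n : ℕ → ℕ} (hn : ∀ k, 2 ≤ n k) {δ : ℝ} (hδ : 0 < δ)
    (hgrow : ∀ᶠ k in atTop, (n k : ℝ) ≤ (basesProd n k : ℝ) ^ δ) {F : Set ℝ}
    (hF : F ⊆ Icc 0 1) {α β : ℝ≥0} (hαβ : (1 + δ) * α < β)
    (hfin : quasiMeasure (packingPreWrt (cantorCylinders n) α) F < ⊤) :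
    quasiMeasure (packingPre β) F = 0 := by
  obtain ⟨ε₁, hε₁, hlt⟩ := exists_pos_lt_top_of_quasiMeasure_lt_top hfin
  obtain ⟨ε₀, hε₀, hcyl⟩ := exists_cylinder_subset_ball hn hδ hgrow
  have hs : 0 < β - (1 + δ) * α := by linarith
  refine quasiMeasure_eq_zero_of_le_rpow
    (K := ((2 : ℝ≥0∞) ^ (1 + δ)) ^ (α : ℝ) * packingPreWrt (cantorCylinders n) α ε₁ F)
    (ENNReal.mul_ne_top (by finiteness) hlt.ne) hs (lt_min hε₀ hε₁) fun ε _ hε => ?_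
  refine iSup₂_le fun P hP => ?_
  have hex : ∀ p : P, ∃ U ∈ cantorCylinders n, p.1.1 ∈ U ∧ U ⊆ Metric.ball p.1.1 p.1.2 ∧
      ENNReal.ofReal (2 * p.1.2) ^ (1 + δ) ≤ 2 ^ (1 + δ) * Metric.ediam U := by
    intro p
    have h := hP.2.1 p p.2
    refine hcyl _ (hF h.2.1) _ h.1 ?_
    rw [← ediam_real_ball (x := p.1.1)]
    exact h.2.2.trans (hε.trans (min_le_left _ _))
  choose φ hφ hxφ hball hle using hex
  have hdisj : ∀ p q : P, p ≠ q → Disjoint (φ p) (φ q) := fun p q hpq =>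
    (hP.2.2 p.2 q.2 (fun h => hpq (Subtype.ext h))).mono (hball p) (hball q)
  have hinj : Function.Injective φ := fun p q hpq => by
    by_contra hne
    exact disjoint_left.1 (hdisj p q hne) (hxφ p) (hpq ▸ hxφ p)
  have hpack : IsPackingBy (cantorCylinders n) F ε₁ (range φ) := by
    have := hP.1.to_subtype
    refine ⟨countable_range φ, range_subset_iff.2 hφ, ?_, ?_⟩
    · rintro _ ⟨p, rfl⟩
      refine ⟨?_, _, hxφ p, (hP.2.1 p p.2).2.1⟩
      exact (Metric.ediam_mono (hball p)).trans
        ((hP.2.1 p p.2).2.2.trans (hε.trans (min_le_right _ _)))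
    · rintro _ ⟨p, rfl⟩ _ ⟨q, rfl⟩ hne
      exact hdisj p q fun h => hne (by rw [h])
  calc ∑' p : P, Metric.ediam (Metric.ball p.1.1 p.1.2) ^ (β : ℝ)
      ≤ ∑' p : P, ((2 : ℝ≥0∞) ^ (1 + δ)) ^ (α : ℝ) * ε ^ (β - (1 + δ) * α) *
          Metric.ediam (φ p) ^ (α : ℝ) := by
        refine ENNReal.tsum_le_tsum fun p => ?_
        have h := hP.2.1 p p.2
        have hpos : 0 < ENNReal.ofReal (2 * p.1.2) := ENNReal.ofReal_pos.2 (by linarith [h.1])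
        have hple : ENNReal.ofReal (2 * p.1.2) ≤ ε := by
          rw [← ediam_real_ball (x := p.1.1)]; exact h.2.2
        have hsplit : (β : ℝ) = (β - (1 + δ) * α) + (1 + δ) * α := by ring
        rw [ediam_real_ball, hsplit, ENNReal.rpow_add _ _ hpos.ne' ENNReal.ofReal_ne_top,
          ENNReal.rpow_mul, ← hsplit]
        calc _ ≤ ε ^ (β - (1 + δ) * α) *
              ((2 : ℝ≥0∞) ^ (1 + δ) * Metric.ediam (φ p)) ^ (α : ℝ) := by
              gcongr
              exact hle p
          _ = _ := by rw [ENNReal.mul_rpow_of_nonneg _ _ α.coe_nonneg]; ring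
    _ = ((2 : ℝ≥0∞) ^ (1 + δ)) ^ (α : ℝ) * ε ^ (β - (1 + δ) * α) *
          ∑' U : range φ, Metric.ediam (U : Set ℝ) ^ (α : ℝ) := by
        rw [ENNReal.tsum_mul_left, tsum_range (fun U : Set ℝ => Metric.ediam U ^ (α : ℝ)) hinj]
    _ ≤ ((2 : ℝ≥0∞) ^ (1 + δ)) ^ (α : ℝ) * ε ^ (β - (1 + δ) * α) *
          packingPreWrt (cantorCylinders n) α ε₁ F := by
        gcongr
        exact le_iSup₂_of_le (range φ) hpack le_rfl
    _ = _ := by ring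

theorem quasiMeasure_packingPreWrt_mono_set {M : Type*} [MetricSpace M] (Φ : Set (Set M)) (α : ℝ≥0)
    {F G : Set M} (h : F ⊆ G) :
    quasiMeasure (packingPreWrt Φ α) F ≤ quasiMeasure (packingPreWrt Φ α) G := by
  refine iInf₂_mono fun ε _ => iSup₂_le fun S hS => ?_
  exact le_iSup₂_of_le S ⟨hS.1, hS.2.1, fun U hU => ⟨(hS.2.2.1 U hU).1,
    (hS.2.2.1 U hU).2.mono (inter_subset_inter_right _ h)⟩, hS.2.2.2⟩ le_rfl

theorem packingDim_le_packingDimWrt {n : ℕ → ℕ} (hn : ∀ k, 2 ≤ n k)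
    (hgrow : ∀ δ : ℝ, 0 < δ → ∀ᶠ k in atTop, (n k : ℝ) ≤ (basesProd n k : ℝ) ^ δ) {E : Set ℝ}
    (hE : E ⊆ Icc 0 1) : packingDim E ≤ packingDimWrt (cantorCylinders n) E := by
  refine le_iInf₂ fun α hα => ?_
  refine le_of_forall_gt_imp_ge_of_dense fun b hb => ?_
  obtain ⟨β, hαβ, hβb⟩ := ENNReal.lt_iff_exists_nnreal_btwn.1 hb
  have hαβ' : (α : ℝ) < β := ENNReal.coe_lt_coe.1 hαβ
  refine (iInf₂_le β ?_).trans hβb.le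
  obtain ⟨F, hEF, hF⟩ := exists_cover_quasiMeasure_lt_top hα
  have hcov : E ⊆ ⋃ j, F j ∩ Icc 0 1 := by
    rw [← iUnion_inter]; exact subset_inter hEF hE
  refine packingMeasureOf_eq_zero_of_cover hcov fun j => ?_
  -- This `δ` makes `δ * α ≤ (β - α) / 2`, hence `(1 + δ) * α < β`; the `+ 1` covers `α = 0`.
  have hδ : 0 < ((β : ℝ) - α) / (2 * (α + 1)) := by
    have := α.coe_nonneg; have : 0 < (β : ℝ) - α := by linarith
    positivity
  refine quasiMeasure_packingPre_eq_zero hn hδ (hgrow _ hδ) inter_subset_right ?_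
    ((quasiMeasure_packingPreWrt_mono_set _ α inter_subset_left).trans_lt (hF j))
  have h0 : (0 : ℝ) ≤ α := α.coe_nonneg
  have h1 : ((β : ℝ) - α) / (2 * (α + 1)) * α ≤ (β - α) / 2 := by
    rw [div_mul_eq_mul_div, div_le_div_iff₀ (by positivity) (by norm_num)]
    nlinarith
  linarith

/-! ### Sets of points with equally spaced digits -/

/-- The digits `b i * (n i / m i)`. -/
def spacedDigits (n m : ℕ → ℕ) (b : ∀ i, Fin (m i)) (i : ℕ) : ℕ := b i * (n i / m i)

/-- The number whose digits are `b i * (n i / m i)`. -/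
noncomputable def spacedPoint (n m : ℕ → ℕ) (b : ∀ i, Fin (m i)) : ℝ :=
  ⨆ k, (cylinderIndex n (spacedDigits n m b) k : ℝ) / basesProd n k

theorem spacedDigits_lt {n m : ℕ → ℕ} (hm : ∀ k, 1 ≤ m k ∧ m k ≤ n k) (b : ∀ i, Fin (m i))
    (i : ℕ) : spacedDigits n m b i < n i := by
  have h1 : 0 < n i / m i := Nat.div_pos (hm i).2 (hm i).1
  calc spacedDigits n m b i < m i * (n i / m i) := Nat.mul_lt_mul_of_pos_right (b i).2 h1
    _ ≤ n i := Nat.mul_div_le _ _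

theorem ciSup_mem_gridCell {n a : ℕ → ℕ} (hn : ∀ k, 2 ≤ n k) (ha : ∀ k, a k < n k) (k : ℕ) :
    (⨆ k, (cylinderIndex n a k : ℝ) / basesProd n k) ∈
      gridCell (basesProd n k) (cylinderIndex n a k) := by
  have hpos : ∀ k, (0 : ℝ) < basesProd n k := fun k => by exact_mod_cast basesProd_pos hn k
  have hnpos : ∀ k, (0 : ℝ) < n k := fun k => by have := hn k; positivity
  refine mem_iInter.1 (Monotone.ciSup_mem_iInter_Icc_of_antitone
    (f := fun k => (cylinderIndex n a k : ℝ) / basesProd n k)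
    (g := fun k => (cylinderIndex n a k + 1 : ℝ) / basesProd n k)
    (monotone_nat_of_le_succ fun k => ?_) (antitone_nat_of_succ_le fun k => ?_) fun k => ?_) k
  · rw [div_le_div_iff₀ (hpos _) (hpos _), basesProd_succ, cylinderIndex]
    push_cast
    nlinarith [mul_nonneg (Nat.cast_nonneg (α := ℝ) (a k)) (hpos k).le]
  · have h1 : (a k + 1 : ℝ) ≤ n k := by exact_mod_cast ha k
    rw [div_le_div_iff₀ (hpos _) (hpos _), basesProd_succ, cylinderIndex]
    push_cast
    nlinarith [mul_le_mul_of_nonneg_left h1 (hpos k).le]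
  · simp only
    gcongr
    linarith

theorem spacedPoint_mem_gridCell {n m : ℕ → ℕ} (hn : ∀ k, 2 ≤ n k)
    (hm : ∀ k, 1 ≤ m k ∧ m k ≤ n k) (b : ∀ i, Fin (m i)) (k : ℕ) :
    spacedPoint n m b ∈ gridCell (basesProd n k) (cylinderIndex n (spacedDigits n m b) k) :=
  ciSup_mem_gridCell hn (spacedDigits_lt hm b) k

theorem range_spacedPoint_subset {n m : ℕ → ℕ} (hn : ∀ k, 2 ≤ n k)
    (hm : ∀ k, 1 ≤ m k ∧ m k ≤ n k) : range (spacedPoint n m) ⊆ Icc 0 1 := by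
  rintro _ ⟨b, rfl⟩
  simpa [gridCell, basesProd, cylinderIndex] using spacedPoint_mem_gridCell hn hm b 0

theorem encard_range_cylinderIndex_le (n m : ℕ → ℕ) (k : ℕ) :
    (range fun b : ∀ i, Fin (m i) => cylinderIndex n (spacedDigits n m b) k).encard ≤
      (basesProd m k : ℕ) := by
  have hex : ∃ s : Finset ℕ, s.card ≤ basesProd m k ∧
      ∀ b : ∀ i, Fin (m i), cylinderIndex n (spacedDigits n m b) k ∈ s := by
    induction k with
    | zero => exact ⟨{0}, by simp [basesProd], fun b => by simp [cylinderIndex]⟩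
    | succ k ih =>
      obtain ⟨s, hs, hmem⟩ := ih
      refine ⟨(s ×ˢ Finset.range (m k)).image fun v => v.1 * n k + v.2 * (n k / m k), ?_,
        fun b => Finset.mem_image.2 ⟨(_, b k), Finset.mem_product.2
          ⟨hmem b, Finset.mem_range.2 (b k).2⟩, rfl⟩⟩
      refine Finset.card_image_le.trans ?_
      rw [Finset.card_product, Finset.card_range, basesProd_succ]
      exact Nat.mul_le_mul_right _ hs
  obtain ⟨s, hs, hmem⟩ := hex
  have hsub : (range fun b : ∀ i, Fin (m i) => cylinderIndex n (spacedDigits n m b) k) ⊆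
      (s : Set ℕ) := range_subset_iff.2 fun b => Finset.mem_coe.2 (hmem b)
  refine (encard_le_encard hsub).trans ?_
  rw [encard_coe_eq_coe_finsetCard]
  exact_mod_cast hs

/-- Cells are closed, so a point in cell `v` can only meet cells `v - 1`, `v` and `v + 1`; hence the
factor 3. -/
theorem encard_meetingCells_range_le {n m : ℕ → ℕ} (hn : ∀ k, 2 ≤ n k)
    (hm : ∀ k, 1 ≤ m k ∧ m k ≤ n k) (k : ℕ) :
    (meetingCells (basesProd n k) (range (spacedPoint n m))).encard ≤
      3 * (basesProd m k : ℕ) := by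
  set R := range fun b : ∀ i, Fin (m i) => cylinderIndex n (spacedDigits n m b) k with hR
  have hpos : (0 : ℝ) < basesProd n k := by exact_mod_cast basesProd_pos hn k
  have hsub : meetingCells (basesProd n k) (range (spacedPoint n m)) ⊆
      (fun i => i - 1) '' R ∪ R ∪ (fun i => i + 1) '' R := by
    rintro i ⟨_, hi, b, rfl⟩
    obtain ⟨h1, h2⟩ := hi
    obtain ⟨h3, h4⟩ := spacedPoint_mem_gridCell hn hm b k
    have hmem : cylinderIndex n (spacedDigits n m b) k ∈ R := ⟨b, rfl⟩
    set v := cylinderIndex n (spacedDigits n m b) k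
    have h5 := (div_le_div_iff_of_pos_right hpos).1 (h1.trans h4)
    have h6 := (div_le_div_iff_of_pos_right hpos).1 (h3.trans h2)
    have h5' : i ≤ v + 1 := by exact_mod_cast h5
    have h6' : v ≤ i + 1 := by exact_mod_cast h6
    rcases (by omega : i = v - 1 ∨ i = v ∨ i = v + 1) with h | h | h
    · exact Or.inl (Or.inl ⟨v, hmem, h.symm⟩)
    · exact Or.inl (Or.inr (h ▸ hmem))
    · exact Or.inr ⟨v, hmem, h.symm⟩
  have hRle := encard_range_cylinderIndex_le n m k
  calc _ ≤ _ := encard_le_encard hsub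
    _ ≤ ((fun i => i - 1) '' R).encard + R.encard + ((fun i => i + 1) '' R).encard :=
      (encard_union_le _ _).trans (add_le_add_left (encard_union_le _ _) _)
    _ ≤ (basesProd m k : ℕ) + (basesProd m k : ℕ) + (basesProd m k : ℕ) := by
      gcongr
      · exact (encard_image_le _ _).trans hRle
      · exact (encard_image_le _ _).trans hRle
    _ = _ := by ring

/-- Baire category in the digit space: the closures of the preimages of the `F j` cover it, so one
has interior and contains a cylinder. This handles arbitrary countable coverings in the lower bound
for the packing dimension. -/
theorem exists_dense_in_cylinder {m : ℕ → ℕ} (hm : ∀ k, 1 ≤ m k) {X : Type*}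
    (f : (∀ i, Fin (m i)) → X) {F : ℕ → Set X} (hF : range f ⊆ ⋃ j, F j) :
    ∃ (j p : ℕ) (b₀ : ∀ i, Fin (m i)), ∀ b ∈ PiNat.cylinder b₀ p, ∀ k,
      ∃ b' ∈ PiNat.cylinder b k, f b' ∈ F j := by
  have : Nonempty (∀ i, Fin (m i)) := ⟨fun i => ⟨0, hm i⟩⟩
  obtain ⟨j, b₁, hb₁⟩ := nonempty_interior_of_iUnion_of_closed
    (f := fun j => closure (f ⁻¹' F j)) (fun j => isClosed_closure) (by
      refine eq_univ_of_forall fun b => ?_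
      obtain ⟨j, hj⟩ := mem_iUnion.1 (hF (mem_range_self b))
      exact mem_iUnion.2 ⟨j, subset_closure hj⟩)
  obtain ⟨_, ⟨b₀, p, rfl⟩, -, hsub⟩ :=
    (PiNat.isTopologicalBasis_cylinders (fun i => Fin (m i))).exists_subset_of_mem_open hb₁
      isOpen_interior
  refine ⟨j, p, b₀, fun b hb k => ?_⟩
  have h1 : b ∈ closure (f ⁻¹' F j) := interior_subset (hsub hb)
  exact mem_closure_iff.1 h1 _ (PiNat.isOpen_cylinder _ b k) (PiNat.self_mem_cylinder b k)

/-- Keeping the first `k` digits of `b₀` and varying digit `k` gives `m k` cells of rank `k + 1`,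
each containing a point of `F` by density. Their spacing makes these points `1 / (4 N_k
m_k)`-separated, a scale between those of the cylinders. -/
theorem mul_rpow_le_packingPre_of_dense {n m : ℕ → ℕ} (hn : ∀ k, 2 ≤ n k)
    (hm : ∀ k, 1 ≤ m k ∧ m k ≤ n k) {F : Set ℝ} {b₀ : ∀ i, Fin (m i)} {p : ℕ}
    (hF : ∀ b ∈ PiNat.cylinder b₀ p, ∀ k, ∃ b' ∈ PiNat.cylinder b k, spacedPoint n m b' ∈ F)
    {k : ℕ} (hpk : p ≤ k) (hk : 2 * m k ≤ n k) {α : ℝ≥0} {ε : ℝ≥0∞}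
    (hε : ENNReal.ofReal (4 * basesProd n k * m k : ℝ)⁻¹ ≤ ε) :
    (m k : ℝ≥0∞) * ENNReal.ofReal (4 * basesProd n k * m k : ℝ)⁻¹ ^ (α : ℝ) ≤
      packingPre α ε F := by
  have hpos : (0 : ℝ) < basesProd n k := by exact_mod_cast basesProd_pos hn k
  have hmpos : (0 : ℝ) < m k := by have := (hm k).1; positivity
  have hnpos : (0 : ℝ) < n k := by have := hn k; positivity
  have hex : ∀ c : Fin (m k), ∃ x ∈ F, x ∈ gridCell (basesProd n (k + 1))
      (cylinderIndex n (spacedDigits n m b₀) k * n k + c * (n k / m k)) := by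
    intro c
    obtain ⟨b', hb', hb'F⟩ := hF (Function.update b₀ k c)
      (fun i hi => Function.update_of_ne (by omega) _ _) (k + 1)
    refine ⟨_, hb'F, ?_⟩
    have h1 := spacedPoint_mem_gridCell hn hm b' (k + 1)
    have h2 : cylinderIndex n (spacedDigits n m b') k =
        cylinderIndex n (spacedDigits n m b₀) k := by
      refine cylinderIndex_congr fun i hi => ?_
      rw [spacedDigits, spacedDigits, hb' i (by omega), Function.update_of_ne hi.ne]
    have h3 : spacedDigits n m b' k = c * (n k / m k) := by
      rw [spacedDigits, hb' k (by omega), Function.update_self]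
    rwa [cylinderIndex, h2, h3] at h1
  choose x hxF hx using hex
  -- With `q = n k / m k ≥ 2`, one has `n k < m k * (q + 1)` and `q + 1 ≤ 4 * (q - 1)`; this is the
  -- source of the constant 4.
  have hq : n k ≤ 4 * (m k * (n k / m k - 1)) := by
    have h1 := Nat.lt_mul_div_succ (n k) (hm k).1
    have h2 : 2 ≤ n k / m k := (Nat.le_div_iff_mul_le (hm k).1).2 hk
    obtain ⟨q, hq⟩ : ∃ q, n k / m k = q + 2 := ⟨n k / m k - 2, by omega⟩
    rw [hq] at h1 ⊢
    have : m k * (q + 2 + 1) ≤ 4 * (m k * (q + 2 - 1)) := by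
      rw [show q + 2 - 1 = q + 1 by omega]; nlinarith
    omega
  have hlt : ∀ c d : Fin (m k), c < d → (4 * basesProd n k * m k : ℝ)⁻¹ ≤ x d - x c := by
    intro c d hcd
    set I := cylinderIndex n (spacedDigits n m b₀) k
    set q := n k / m k
    have hq1 : 1 ≤ q := Nat.div_pos (hm k).2 (hm k).1
    have hq' : (n k : ℝ) ≤ 4 * (m k * ((q : ℝ) - 1)) := by
      have : ((n k : ℕ) : ℝ) ≤ ((4 * (m k * (q - 1)) : ℕ) : ℝ) := by exact_mod_cast hq
      rwa [Nat.cast_mul, Nat.cast_mul, Nat.cast_sub hq1, Nat.cast_one, Nat.cast_ofNat] at this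
    have h1 := (hx c).2
    have h2 := (hx d).1
    rw [basesProd_succ] at h1 h2
    have h3 : ((c : ℕ) : ℝ) + 1 ≤ (d : ℕ) := by exact_mod_cast hcd
    -- The gap runs from the right end of one cell to the left end of the other, which costs one
    -- cell: `q - 1` instead of `q`.
    have h4 : ((q : ℝ) - 1) / (basesProd n k * n k) ≤
        ((I * n k + d * q : ℕ) : ℝ) / (basesProd n k * n k : ℕ) -
          (((I * n k + c * q : ℕ) : ℝ) + 1) / (basesProd n k * n k : ℕ) := by
      rw [← sub_div]
      push_cast
      refine div_le_div_of_nonneg_right ?_ (by positivity)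
      nlinarith [mul_le_mul_of_nonneg_right h3 (Nat.cast_nonneg (α := ℝ) q)]
    have h5 : (4 * basesProd n k * m k : ℝ)⁻¹ ≤ ((q : ℝ) - 1) / (basesProd n k * n k) := by
      rw [inv_eq_one_div, div_le_div_iff₀ (by positivity) (by positivity)]
      nlinarith [mul_le_mul_of_nonneg_left hq' hpos.le]
    linarith
  have h := encard_mul_le_packingPre (F := F) (α := α) (ε := ε)
    (r := (4 * basesProd n k * m k : ℝ)⁻¹ / 2) (by positivity)
    (by rwa [mul_div_cancel₀ _ (two_ne_zero' ℝ)]) (univ : Set (Fin (m k))) x (fun c _ => hxF c) (by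
      intro c _ d _ hcd
      rw [mul_div_cancel₀ _ (two_ne_zero' ℝ), Real.dist_eq]
      rcases lt_or_gt_of_ne hcd with h | h
      · rw [abs_sub_comm]; exact (hlt c d h).trans (le_abs_self _)
      · exact (hlt d c h).trans (le_abs_self _))
  rw [mul_div_cancel₀ _ (two_ne_zero' ℝ)] at h
  simpa [encard_univ] using h

/-! ### Rapidly growing bases -/

/-- The number of digits allowed at position `k` when `C` words of length `k` are allowed: it is
about `N ^ η` with `N = basesProd n k` if `n k` is at least `N ^ (2 η)` and `C` is at most `N ^ e`,
and `1` otherwise. -/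
noncomputable def greedyCount (n : ℕ → ℕ) (η e : ℝ) (k C : ℕ) : ℕ :=
  open Classical in
  if (basesProd n k : ℝ) ^ (2 * η) ≤ n k ∧ (C : ℝ) ≤ (basesProd n k : ℝ) ^ e then
    ⌊(basesProd n k : ℝ) ^ η⌋₊ else 1

/-- The number of words of length `k` with digits chosen by `greedyCount`. -/
noncomputable def greedyWords (n : ℕ → ℕ) (η e : ℝ) : ℕ → ℕ
  | 0 => 1
  | k + 1 => greedyWords n η e k * greedyCount n η e k (greedyWords n η e k)

/-- The numbers of digits chosen by `greedyCount`. -/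
noncomputable def greedyDigits (n : ℕ → ℕ) (η e : ℝ) (k : ℕ) : ℕ :=
  greedyCount n η e k (greedyWords n η e k)

/-- The positions at which more than one digit may be allowed. -/
def IsGreedyPosition (n : ℕ → ℕ) (η e : ℝ) (k : ℕ) : Prop :=
  (basesProd n k : ℝ) ^ (2 * η) ≤ n k ∧ (greedyWords n η e k : ℝ) ≤ (basesProd n k : ℝ) ^ e

section Greedy

variable {n : ℕ → ℕ} {η e : ℝ}

theorem greedyWords_eq (k : ℕ) : greedyWords n η e k = basesProd (greedyDigits n η e) k := by
  induction k with
  | zero => simp [greedyWords, basesProd]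
  | succ k ih => rw [basesProd_succ, ← ih]; rfl

theorem greedyDigits_of_pos {k : ℕ} (h : IsGreedyPosition n η e k) :
    greedyDigits n η e k = ⌊(basesProd n k : ℝ) ^ η⌋₊ := by
  rw [greedyDigits, greedyCount]; exact if_pos h

theorem greedyDigits_of_neg {k : ℕ} (h : ¬ IsGreedyPosition n η e k) :
    greedyDigits n η e k = 1 := by
  rw [greedyDigits, greedyCount]; exact if_neg h

theorem one_le_basesProd (hn : ∀ k, 2 ≤ n k) (k : ℕ) : (1 : ℝ) ≤ basesProd n k := by
  exact_mod_cast basesProd_pos hn k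

theorem greedyDigits_bounds (hn : ∀ k, 2 ≤ n k) (hη : 0 < η) (k : ℕ) :
    1 ≤ greedyDigits n η e k ∧ greedyDigits n η e k ≤ n k := by
  have h1 := one_le_basesProd hn k
  by_cases h : IsGreedyPosition n η e k
  · rw [greedyDigits_of_pos h]
    refine ⟨Nat.le_floor (by simpa using Real.one_le_rpow h1 hη.le), Nat.floor_le_of_le ?_⟩
    exact (Real.rpow_le_rpow_of_exponent_le h1 (by linarith)).trans h.1
  · rw [greedyDigits_of_neg h]
    exact ⟨le_rfl, by linarith [hn k]⟩

/-- At a greedy position the count becomes at most `N_k ^ (e + η)` while `N_(k+1) ≥ N_k ^ (1 + 2 *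
η)`, whence the quotient of exponents. Elsewhere the count is unchanged and `N_k` grows. -/
theorem greedyWords_le (hn : ∀ k, 2 ≤ n k) (hη : 0 < η) (he : 0 < e) (k : ℕ) :
    (greedyWords n η e k : ℝ) ≤ (basesProd n k : ℝ) ^ ((e + η) / (1 + 2 * η)) := by
  have ht : 0 < (e + η) / (1 + 2 * η) := by positivity
  induction k with
  | zero => simp [greedyWords, basesProd]
  | succ k ih =>
    have h1 := one_le_basesProd hn k
    have h0 : (0 : ℝ) < basesProd n k := by linarith
    have hw : greedyWords n η e (k + 1) = greedyWords n η e k * greedyDigits n η e k := rfl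
    rw [hw]
    by_cases h : IsGreedyPosition n η e k
    · rw [greedyDigits_of_pos h]
      push_cast
      calc _ ≤ (basesProd n k : ℝ) ^ e * (basesProd n k : ℝ) ^ η := by
            gcongr
            · exact h.2
            · exact Nat.floor_le (by positivity)
        _ = ((basesProd n k : ℝ) ^ (1 + 2 * η)) ^ ((e + η) / (1 + 2 * η)) := by
            rw [← Real.rpow_add h0, ← Real.rpow_mul h0.le, mul_div_cancel₀ _ (by positivity)]
        _ ≤ _ := by
            refine Real.rpow_le_rpow (by positivity) ?_ ht.le
            rw [Real.rpow_add h0, Real.rpow_one, basesProd_succ]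
            push_cast
            exact mul_le_mul_of_nonneg_left h.1 h0.le
    · rw [greedyDigits_of_neg h, mul_one]
      refine ih.trans (Real.rpow_le_rpow h0.le ?_ ht.le)
      exact_mod_cast ((basesProd_strictMono hn) k.lt_succ_self).le

/-- If greedy positions stopped, the word count would become constant and `N_k ^ e` would overtake
it, so the next large base would give another one. -/
theorem frequently_isGreedyPosition (hn : ∀ k, 2 ≤ n k) (he : 0 < e)
    (hfreq : ∃ᶠ k in atTop, (basesProd n k : ℝ) ^ (2 * η) ≤ n k) :
    ∃ᶠ k in atTop, IsGreedyPosition n η e k := by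
  intro hev
  obtain ⟨k₀, hk₀⟩ := eventually_atTop.1 hev
  have hconst : ∀ k ≥ k₀, greedyWords n η e k = greedyWords n η e k₀ := by
    intro k hk
    induction k, hk using Nat.le_induction with
    | base => rfl
    | succ k hk ih =>
      have hw : greedyWords n η e (k + 1) = greedyWords n η e k * greedyDigits n η e k := rfl
      rw [hw, greedyDigits_of_neg (hk₀ k hk), mul_one, ih]
  have hlarge := ((tendsto_rpow_atTop he).comp (tendsto_basesProd hn)).eventually_ge_atTop
    (greedyWords n η e k₀ : ℝ)
  obtain ⟨k, hk, h1, h2⟩ := (hfreq.and_eventually (hlarge.and (eventually_ge_atTop k₀))).exists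
  exact hk₀ k h2 ⟨hk, by rw [hconst k h2]; exact h1⟩

/-- The set of points all of whose digits are allowed by the greedy choice. -/
noncomputable def greedySet (n : ℕ → ℕ) (η e : ℝ) : Set ℝ :=
  range (spacedPoint n (greedyDigits n η e))

theorem packingDimWrt_greedySet_le (hn : ∀ k, 2 ≤ n k) (hη : 0 < η) (he : 0 < e) {β : ℝ≥0}
    (hβ : (e + η) / (1 + 2 * η) < β) :
    packingDimWrt (cantorCylinders n) (greedySet n η e) ≤ β := by
  have ht : 0 ≤ (e + η) / (1 + 2 * η) := by positivity
  refine iInf₂_le β (packingMeasureOf_eq_zero_of_cover (F := fun _ => greedySet n η e)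
    (subset_iUnion (fun _ : ℕ => greedySet n η e) 0) fun _ => ?_)
  refine quasiMeasure_packingPreWrt_eq_zero hn (α := ⟨_, ht⟩) (M := 3) (ε₀ := 1) hβ (by norm_num)
    one_pos fun k _ => ?_
  have hpos : (0 : ℝ) < basesProd n k := by exact_mod_cast basesProd_pos hn k
  have h1 := encard_meetingCells_range_le hn (greedyDigits_bounds (e := e) hn hη) k
  rw [← greedyWords_eq] at h1
  have h2 : ((meetingCells (basesProd n k) (greedySet n η e)).encard : ℝ≥0∞) ≤
      3 * (greedyWords n η e k : ℕ) := by exact_mod_cast ENat.toENNReal_le.2 h1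
  have h3 : ((greedyWords n η e k : ℕ) : ℝ≥0∞) ≤
      (basesProd n k : ℝ≥0∞) ^ ((e + η) / (1 + 2 * η)) := by
    have := ENNReal.ofReal_le_ofReal (greedyWords_le hn hη he k)
    rwa [ENNReal.ofReal_natCast, ← ENNReal.ofReal_rpow_of_pos hpos,
      ENNReal.ofReal_natCast] at this
  change _ * ((basesProd n k : ℝ≥0∞)⁻¹) ^ ((e + η) / (1 + 2 * η)) ≤ 3
  calc _ ≤ 3 * (basesProd n k : ℝ≥0∞) ^ ((e + η) / (1 + 2 * η)) *
        ((basesProd n k : ℝ≥0∞)⁻¹) ^ ((e + η) / (1 + 2 * η)) := by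
        gcongr
        exact h2.trans (by gcongr)
    _ = 3 := by
        rw [mul_assoc, ← ENNReal.mul_rpow_of_nonneg _ _ ht, ENNReal.mul_inv_cancel
          (by exact_mod_cast (basesProd_pos hn k).ne') (ENNReal.natCast_ne_top _),
          ENNReal.one_rpow, mul_one]

/-- At a greedy position, about `N ^ η` balls of diameter about `N ^ (-(1 + η))` contribute about `N
^ (η - (1 + η) * α)`. For `α < η / (1 + η)` this is unbounded, against finiteness of the premeasure
of the piece found by Baire category. -/
theorem le_packingDim_greedySet (hn : ∀ k, 2 ≤ n k) (hη : 0 < η) (he : 0 < e)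
    (hfreq : ∃ᶠ k in atTop, (basesProd n k : ℝ) ^ (2 * η) ≤ n k) {γ : ℝ≥0}
    (hγ : (γ : ℝ) = η / (1 + η)) : (γ : ℝ≥0∞) ≤ packingDim (greedySet n η e) := by
  refine le_iInf₂ fun α hα => ENNReal.coe_le_coe.2 ?_
  by_contra hlt
  have hαγ : (α : ℝ) < η / (1 + η) := by rw [← hγ]; exact not_le.1 hlt
  have hs : 0 < η - (1 + η) * α := by
    rw [lt_div_iff₀ (by positivity)] at hαγ; linarith
  have hm := greedyDigits_bounds (e := e) hn hη
  obtain ⟨F, hcov, hfin⟩ := exists_cover_quasiMeasure_lt_top hα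
  obtain ⟨j, p, b₀, hdense⟩ := exists_dense_in_cylinder (fun k => (hm k).1) _ hcov
  obtain ⟨ε, hε, hM⟩ := exists_pos_lt_top_of_quasiMeasure_lt_top (hfin j)
  have hN := tendsto_basesProd hn
  have hlarge := ((tendsto_rpow_atTop hs).comp hN).eventually_gt_atTop
    ((packingPre α ε (F j)).toReal * (2 * 4 ^ (α : ℝ)))
  have hlarge2 := ((tendsto_rpow_atTop hη).comp hN).eventually_ge_atTop 2
  have hsmall : ∀ᶠ k in atTop, ENNReal.ofReal (basesProd n k : ℝ)⁻¹ < ε := by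
    have h1 := ENNReal.tendsto_ofReal (tendsto_inv_atTop_zero.comp hN)
    rw [ENNReal.ofReal_zero] at h1
    exact h1.eventually_lt_const hε
  obtain ⟨k, hk, hk1, hk2, hk3, hpk⟩ := ((frequently_isGreedyPosition hn he hfreq).and_eventually
    (hlarge.and (hlarge2.and (hsmall.and (eventually_ge_atTop p))))).exists
  simp only [Function.comp_apply] at hk1 hk2
  set N : ℝ := (basesProd n k : ℝ) with hNdef
  set m := greedyDigits n η e k with hmdef
  have hN1 : 1 ≤ N := one_le_basesProd hn k
  have hN0 : 0 < N := by linarith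
  have hm1 : (1 : ℝ) ≤ m := by exact_mod_cast (hm k).1
  have hmle : (m : ℝ) ≤ N ^ η := by
    rw [hmdef, greedyDigits_of_pos hk]; exact Nat.floor_le (by positivity)
  have hmge : N ^ η / 2 ≤ m := by
    have : N ^ η < m + 1 := by
      rw [hmdef, greedyDigits_of_pos hk]; exact Nat.lt_floor_add_one _
    linarith
  have h2m : 2 * m ≤ n k := by
    have h1 : (2 : ℝ) * m ≤ n k := by
      refine le_trans ?_ hk.1
      rw [two_mul η, Real.rpow_add hN0]
      gcongr
    exact_mod_cast h1
  have hdiam : (4 * N * m : ℝ)⁻¹ ≤ N⁻¹ := inv_anti₀ hN0 (by nlinarith)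
  have h1 := mul_rpow_le_packingPre_of_dense hn hm hdense hpk h2m (α := α) (ε := ε)
    ((ENNReal.ofReal_le_ofReal hdiam).trans hk3.le)
  have h2 : (m : ℝ) * ((4 * N * m : ℝ)⁻¹) ^ (α : ℝ) ≤ (packingPre α ε (F j)).toReal := by
    have h3 := ENNReal.toReal_mono hM.ne h1
    rwa [ENNReal.toReal_mul, ENNReal.toReal_natCast, ← ENNReal.toReal_rpow,
      ENNReal.toReal_ofReal (by positivity)] at h3
  have h3 : N ^ (η - (1 + η) * α) / (2 * 4 ^ (α : ℝ)) ≤ (m : ℝ) * ((4 * N * m : ℝ)⁻¹) ^ (α : ℝ) := by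
    have h4 : ((4 * N ^ (1 + η))⁻¹) ^ (α : ℝ) ≤ ((4 * N * m : ℝ)⁻¹) ^ (α : ℝ) := by
      refine Real.rpow_le_rpow (by positivity) (inv_anti₀ (by positivity) ?_) α.coe_nonneg
      rw [Real.rpow_add hN0, Real.rpow_one, ← mul_assoc]
      gcongr
    calc N ^ (η - (1 + η) * α) / (2 * 4 ^ (α : ℝ))
        = N ^ η / 2 * ((4 * N ^ (1 + η))⁻¹) ^ (α : ℝ) := by
          rw [Real.inv_rpow (by positivity), Real.mul_rpow (by norm_num) (by positivity),
            ← Real.rpow_mul hN0.le, Real.rpow_sub hN0]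
          field_simp
      _ ≤ _ := by gcongr
  have h5 := h3.trans h2
  rw [div_le_iff₀ (by positivity)] at h5
  linarith

end Greedy

theorem packingDimWrt_lt_packingDim_greedySet {n : ℕ → ℕ} (hn : ∀ k, 2 ≤ n k) {η : ℝ} (hη : 0 < η)
    (hfreq : ∃ᶠ k in atTop, (basesProd n k : ℝ) ^ (2 * η) ≤ n k) :
    packingDimWrt (cantorCylinders n) (greedySet n η (η ^ 2 / (2 * (1 + η)))) <
      packingDim (greedySet n η (η ^ 2 / (2 * (1 + η)))) := by
  have he : 0 < η ^ 2 / (2 * (1 + η)) := by positivity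
  -- With `e` the first summand, cross-multiplying reduces this to `e * (1 + η) < η ^ 2`; the chosen
  -- `e` gives half of `η ^ 2`.
  have hlt : (η ^ 2 / (2 * (1 + η)) + η) / (1 + 2 * η) < η / (1 + η) := by
    rw [div_add' _ _ _ (by positivity), div_div, div_lt_div_iff₀ (by positivity) (by positivity)]
    have : 0 < η ^ 2 * (1 + η) := by positivity
    nlinarith
  obtain ⟨β, hβ1, hβ2⟩ := exists_between hlt
  lift β to ℝ≥0 using le_trans (by positivity) hβ1.le
  obtain ⟨γ, hγ⟩ : ∃ γ : ℝ≥0, (γ : ℝ) = η / (1 + η) := ⟨⟨η / (1 + η), by positivity⟩, rfl⟩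
  rw [← hγ] at hβ2
  exact (packingDimWrt_greedySet_le hn hη he hβ1).trans_lt
    ((ENNReal.coe_lt_coe.2 hβ2).trans_le (le_packingDim_greedySet hn hη he hfreq hγ))

/-! ### The logarithmic growth condition and the equivalence -/

theorem tendsto_log_div_log_iff {n : ℕ → ℕ} (hn : ∀ k, 2 ≤ n k) :
    Tendsto (fun k : ℕ => Real.log (n k) / Real.log (∏ i ∈ Finset.range k, (n i : ℝ)))
        atTop (𝓝 0) ↔
      ∀ δ : ℝ, 0 < δ → ∀ᶠ k in atTop, (n k : ℝ) ≤ (basesProd n k : ℝ) ^ δ := by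
  have hprod : ∀ k, ∏ i ∈ Finset.range k, (n i : ℝ) = basesProd n k := fun k => by
    rw [basesProd, Nat.cast_prod]
  have hnpos : ∀ k, (0 : ℝ) < n k := fun k => by have := hn k; positivity
  have hpos : ∀ k, (0 : ℝ) < basesProd n k := fun k => by exact_mod_cast basesProd_pos hn k
  -- Rank 0 is left out: its product is empty and its logarithm is 0.
  have hlog : ∀ k ≥ 1, 0 < Real.log (basesProd n k) := fun k hk =>
    Real.log_pos (by
      have := two_pow_le_basesProd hn k
      have h2 : 1 < 2 ^ k := Nat.one_lt_two_pow (by omega)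
      exact_mod_cast h2.trans_le this)
  have hle : ∀ k ≥ 1, ∀ δ : ℝ, Real.log (n k) / Real.log (basesProd n k) ≤ δ ↔
      (n k : ℝ) ≤ (basesProd n k : ℝ) ^ δ := fun k hk δ => by
    rw [div_le_iff₀ (hlog k hk), ← Real.log_rpow (hpos k),
      Real.log_le_log_iff (hnpos k) (Real.rpow_pos_of_pos (hpos k) _)]
  simp only [hprod]
  constructor
  · intro h δ hδ
    filter_upwards [h.eventually_lt_const hδ, eventually_ge_atTop 1] with k hk hk1
    exact (hle k hk1 δ).1 hk.le
  · intro h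
    refine tendsto_order.2 ⟨fun a ha => Eventually.of_forall fun k => ha.trans_le ?_, fun a ha => ?_⟩
    · exact div_nonneg (Real.log_natCast_nonneg _) (Real.log_natCast_nonneg _)
    · filter_upwards [h _ (half_pos ha), eventually_ge_atTop 1] with k hk hk1
      exact ((hle k hk1 _).2 hk).trans_lt (half_lt_self ha)

theorem mainTheorem1 (n : ℕ → ℕ) (hn : ∀ k, 2 ≤ n k) :
    IsPackingFaithful (cantorCylinders n) ↔
      Tendsto (fun k : ℕ => Real.log (n k) / Real.log (∏ i ∈ Finset.range k, (n i : ℝ)))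
        atTop (𝓝 0) := by
  rw [tendsto_log_div_log_iff hn]
  constructor
  · intro hfaith
    by_contra! hcon
    obtain ⟨δ, hδ, hfreq⟩ := hcon
    have hfreq' : ∃ᶠ k in atTop, (basesProd n k : ℝ) ^ (2 * (δ / 2)) ≤ n k := by
      rw [mul_div_cancel₀ _ (two_ne_zero' ℝ)]
      exact hfreq.mono fun k hk => hk.le
    refine (packingDimWrt_lt_packingDim_greedySet hn (half_pos hδ) hfreq').ne (hfaith _ ?_)
    exact range_spacedPoint_subset hn (greedyDigits_bounds hn (half_pos hδ))
  · intro hgrow E hE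
    exact le_antisymm (packingDimWrt_cantorCylinders_le hn E)
      (packingDim_le_packingDimWrt hn hgrow hE)
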